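/- **Setting.** A server holds $N$ files and serves $K$ users over a noiseless broadcast link; each user has a cache of size $M>0$ files. Write $q=\lceil N/M\rceil$. Each file is split into $F=qF'$ packets, arranged in $F'$ groups of $q$ packets. *NewPlacement.* Each user, for each file and each of its $F'$ groups, stores one packet of the group, chosen uniformly at random; all choices are independent. *NewDelivery* (for a set $U$ of users with demands $d_k$, where $S_{n,f}\subseteq U$ is the set of users of $U$ assumed to store packet $f$ of file $n$). Start with $C=\emptyset$ and run through all pairs $(k,f)$, $k\in U$, $f$ a packet index, in any order. If $k\in S_{d_k,f}$ or $(k,f)\in C$, skip the pair. Otherwise, for each $j\in S_{d_k,f}$ for which there is an $f'$ with $(j,f')\notin C$ and $S_{d_j,f'}=(S_{d_k,f}\cup\{k\})\setminus\{j\}$, select one such $f'$ (by any rule); transmit the XOR of packet $f$ of file $d_k$ with packet $f'$ of file $d_j$ for all selected pairs $(j,f')$, and add $(k,f)$ and all selected pairs to $C$. *ModifiedDelivery* with target gain $g$. First replace each $S_{n,f}$ with $|S_{n,f}|\ge g+1$ by a uniformly random $g$-subset of itself, independently over all packets $(n,f)$; then run NewDelivery with the new sets. The rate is the number of transmitted packets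 divided by $F$. **Theorem.** Let $\lceil N/M\rceil\ge e$ and let $g$ be an integer with $7\le g\le\frac{(N/M)^2}{3\log(N/M)}$. Let $K'=\big\lceil\lceil N/M\rceil\,3g\log(N/M)\big\rceil$, let $K$ be a multiple of $K'$, and divide the users into groups of size $K'$. Use NewPlacement, and run ModifiedDelivery with target gain $g$ separately in each group (with the sets of users of that group storing each packet, and with independent randomness in the groups). There are an absolute constant $c>0$ and a function $\varepsilon$ with $\varepsilon(x)\to0$ as $x\to\infty$ such that, with $$F_0=\lceil N/M\rceil\left\lceil c\binom{K'}{g}\Big(\log\binom{K'}{g}\Big)^2\right\rceil ,$$ for all such $N,M,g,K$, all file sizes $F=\lceil N/M\rceil F'\ge F_0$ and every demand pattern, the expected total rate over all groups (with respect to the placement and the delivery) is at most $$\frac43\,\frac{K}{g+1}\,\bigl(1+\varepsilon(K')\bigr).$$ Moreover, with absolute implied constants, $$F_0=O\!\left(\binom{K'}{g}\Big(\log\binom{K'}{g}\Big)^2\lceil N/M\rceil\right)\quad\text{and}\quad F_0=O\!\left(\lceil N/M\rceil^{g+1}(3e)^g(\log(N/M))^{g+2}g^2\right),$$ and, for every $A>0$,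 in the range $g\le A\,N/M$ (in particular for every fixed $g$), $F_0=O_A\!\left((N/M)^{g+1}(3e)^g(\log(N/M))^{g+2}g^2\right)$. -/

import Mathlib

namespace CodedCaching

open Finset

/-- A cache configuration for users `U`, a library of `N` files and packets (of each file) `P`:
`S n f` is the exact set of users that store packet `f` of file `n`. -/
abbrev Config (U P : Type) (N : ℕ) : Type := Fin N → P → Finset U

/-- The possible outcomes of the random placement: every file consists of `F'` groups of `q` packets,
and every user `k` chooses, for every file `n` and every group `f'`, one packet of that group.
The placement chooses uniformly among these outcomes, i.e. all the choices are uniform and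
mutually independent. -/
abbrev Placement (U : Type) (N F' q : ℕ) : Type := U → Fin N → Fin F' → Fin q

/-- The cache configuration of a placement; the packet `(f', i)` is the `i`-th packet of the
`f'`-th group, so a file has `F' * q` packets. -/
def Placement.config {U : Type} [Fintype U] {N F' q : ℕ} (ω : Placement U N F' q) :
    Config U (Fin F' × Fin q) N :=
  fun n p => univ.filter fun k => ω k n p.1 = p.2

/-- What the description of the delivery algorithm leaves open: the order in which the
main loop runs through all pairs (user, packet of the requested file), and the choice of one packet
whenever several are suitable. -/
structure Schedule (U P : Type) where
  order : List (U × P)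
  nodup : order.Nodup
  complete : ∀ x, x ∈ order
  pick : ∀ s : Finset P, s.Nonempty → {f : P // f ∈ s}

section Delivery

variable {U P : Type} [DecidableEq U] [Fintype P] [DecidableEq P] {N : ℕ}

/-- The packets not yet covered by `C` that are requested by `j` and stored exactly in
`S_{d_k,f} ∪ {k} - {j}`. -/
def candidates (S : Config U P N) (d : U → Fin N) (C : Finset (U × P)) (x : U × P) (j : U) :
    Finset P :=
  univ.filter fun f' => (j, f') ∉ C ∧ S (d j) f' = (insert x.1 (S (d x.1) x.2)).erase j

/-- The set `A` of packets that are XORed with the packet `x = (k, f)`: one candidate for each user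
`j ∈ S_{d_k,f}` that has one. -/
def partners (σ : Schedule U P) (S : Config U P N) (d : U → Fin N) (C : Finset (U × P))
    (x : U × P) : Finset (U × P) :=
  (S (d x.1) x.2).biUnion fun j =>
    if h : (candidates S d C x j).Nonempty then {(j, (σ.pick _ h).1)} else ∅

/-- One iteration of the main loop. The state is the pair of the set `C` of covered packets and the
list of the transmissions made so far, a transmission being the set of packets that are XORed. -/
def deliveryStep (σ : Schedule U P) (S : Config U P N) (d : U → Fin N)
    (st : Finset (U × P) × List (Finset (U × P))) (x : U × P) :
    Finset (U × P) × List (Finset (U × P)) :=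
  if x.1 ∈ S (d x.1) x.2 ∨ x ∈ st.1 then st
  else (st.1 ∪ insert x (partners σ S d st.1 x), insert x (partners σ S d st.1 x) :: st.2)

/-- The list of the transmissions of the greedy clique cover delivery (`NewDelivery`) for the cache
configuration `S` and the demands `d`. -/
def newDelivery (σ : Schedule U P) (S : Config U P N) (d : U → Fin N) :
    List (Finset (U × P)) :=
  (σ.order.foldl (deliveryStep σ S d) (∅, [])).2

/-- The normalized number of transmissions: number of packets sent divided by the number of
packets per file. -/
noncomputable def deliveryRate (σ : Schedule U P) (S : Config U P N) (d : U → Fin N) : ℝ :=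
  ((newDelivery σ S d).length : ℝ) / (Fintype.card P : ℝ)

/-- The possible outcomes of the pull-down phase with target gain `g`: every `S n f` with at least
`g + 1` elements is replaced by one of its `g`-subsets. The pull-down phase chooses uniformly among
these outcomes, i.e. the `g`-subsets are uniform and independent over all packets. (Files that are
not requested have no influence on the delivery.) -/
def pullDown (g : ℕ) (S : Config U P N) : Finset (Config U P N) :=
  Fintype.piFinset fun n => Fintype.piFinset fun f =>
    if g + 1 ≤ (S n f).card then (S n f).powersetCard g else {S n f}

end Delivery

/-- The users of group `j`. -/
abbrev Group {K m : ℕ} (grp : Fin K → Fin m) (j : Fin m) : Type := {k : Fin K // grp k = j}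

/-- The cache configuration seen by the users of group `j`. -/
def groupConfig {K m N F' q : ℕ} (grp : Fin K → Fin m) (ω : Placement (Fin K) N F' q)
    (j : Fin m) : Config (Group grp j) (Fin F' × Fin q) N :=
  Placement.config fun k => ω k.1

/-- The expectation, over the random placement and over the random pull-down phases of all groups,
of the total normalized number of transmissions when `ModifiedDelivery` (pull-down phase followed
by `NewDelivery`) is run separately in every group of users. -/
noncomputable def expectedTotalRate {K m N F' q : ℕ} (g : ℕ) (grp : Fin K → Fin m)
    (σ : ∀ j, Schedule (Group grp j) (Fin F' × Fin q)) (d : Fin K → Fin N) : ℝ :=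
  Finset.expect (univ : Finset (Placement (Fin K) N F' q)) fun ω =>
    Finset.expect (Fintype.piFinset fun j => pullDown g (groupConfig grp ω j)) fun T =>
      ∑ j, deliveryRate (σ j) (T j) fun k => d k.1

/-- `⌈N/M⌉`. -/
noncomputable def ratio (N : ℕ) (M : ℝ) : ℕ := ⌈(N : ℝ) / M⌉₊

/-- The group size `⌈N/M⌉ · 3 g log (N/M)`, rounded up to an integer. -/
noncomputable def groupSize (N : ℕ) (M : ℝ) (g : ℕ) : ℕ :=
  ⌈(ratio N M : ℝ) * (3 * g * Real.log ((N : ℝ) / M))⌉₊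

/-- `binom(K', g) (log binom(K', g))²` for the group size `K'`. -/
noncomputable def groupOrder (N : ℕ) (M : ℝ) (g : ℕ) : ℝ :=
  ((groupSize N M g).choose g : ℝ) * Real.log ((groupSize N M g).choose g : ℝ) ^ 2

/-- The range of the parameters. -/
def Admissible (N : ℕ) (M : ℝ) (g : ℕ) : Prop :=
  0 < M ∧ Real.exp 1 ≤ (ratio N M : ℝ) ∧ 7 ≤ g ∧
    (g : ℝ) ≤ ((N : ℝ) / M) ^ 2 / (3 * Real.log ((N : ℝ) / M))

/-- The number of packets per file `F = ⌈N/M⌉ F'` with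
`F' = ⌈c binom(K', g) (log binom(K', g))²⌉`. -/
noncomputable def fileSize (c : ℝ) (N : ℕ) (M : ℝ) (g : ℕ) : ℕ :=
  ratio N M * ⌈c * groupOrder N M g⌉₊

end CodedCaching

/-!
Every transmission of the greedy delivery serves all members of some set `B` of users that still
miss a packet stored exactly at the rest of `B`. Hence it decreases the sum over `B` of the largest
number of uncovered packets that a member `k` of `B` requests and that are stored exactly in
`B \ {k}`, and the initial value of this sum bounds the number of transmissions.

After the pull-down phase only the sets `B` of size `g + 1` and the packets stored at fewer than `g`
users contribute. By symmetry a file has on average at most `Λ = F / binom(K', g)` packets stored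
exactly in a given set of `g` users. The corresponding indicators are not positively correlated, as
no user stores two packets of one group, so the variance is at most the mean, and by Jensen's
inequality the expected maximum over `B` is at most `Λ + √((g + 1) Λ)`. Summed over `B` and divided
by `F`, the term `Λ` gives at most `K' / (g + 1)`. Chernoff's bound controls the packets stored at
fewer than `g` users.
-/

namespace CodedCaching

open Finset
open scoped BigOperators

section Expectation

variable {ι : Type*} [DecidableEq ι]

theorem expect_piFinset_prod [Fintype ι] {κ : ι → Type*} {t : ∀ i, Finset (κ i)}
    (ht : ∀ i, (t i).Nonempty) (s : Finset ι) (f : ∀ i, κ i → ℝ) :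
    𝔼 x ∈ Fintype.piFinset t, ∏ i ∈ s, f i (x i) = ∏ i ∈ s, 𝔼 a ∈ t i, f i a := by
  have expect_ite : ∀ i, (if i ∈ s then 𝔼 a ∈ t i, f i a else 1) =
      𝔼 a ∈ t i, if i ∈ s then f i a else 1 := fun i => by
    split_ifs
    · rfl
    · rw [expect_const (ht i)]
  simp only [← Fintype.prod_ite_mem s, expect_ite]
  simp only [expect_eq_sum_div_card, prod_div_distrib, prod_univ_sum, Fintype.card_piFinset,
    Nat.cast_prod]

theorem expect_piFinset_apply [Fintype ι] {κ : ι → Type*} {t : ∀ i, Finset (κ i)}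
    (ht : ∀ i, (t i).Nonempty) (i : ι) (φ : κ i → ℝ) :
    𝔼 x ∈ Fintype.piFinset t, φ (x i) = 𝔼 a ∈ t i, φ a := by
  simpa using expect_piFinset_prod ht {i} (Function.update (fun _ _ => 0) i φ)

theorem expect_piFinset_mul [Fintype ι] {κ : ι → Type*} {t : ∀ i, Finset (κ i)}
    (ht : ∀ i, (t i).Nonempty) {i j : ι} (hij : i ≠ j) (φ : κ i → ℝ) (ψ : κ j → ℝ) :
    𝔼 x ∈ Fintype.piFinset t, φ (x i) * ψ (x j) = (𝔼 a ∈ t i, φ a) * 𝔼 a ∈ t j, ψ a := by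
  simpa [prod_pair hij, hij] using expect_piFinset_prod ht {i, j}
    (Function.update (Function.update (fun _ _ => 0) i φ) j ψ)

theorem expect_subtype_restrict {V : Type*} [Fintype ι] [Fintype V] [Nonempty V] (p : ι → Prop)
    [DecidablePred p] (φ : ({i // p i} → V) → ℝ) :
    𝔼 ω : ι → V, φ (fun i => ω i) = 𝔼 v, φ v := by
  rw [Fintype.expect_equiv (Equiv.piEquivPiSubtypeProd p fun _ => V)
    (fun ω => φ fun i => ω i) (fun x => φ x.1) fun _ => rfl, ← univ_product_univ, expect_product]
  simp only [Fintype.expect_const]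

omit [DecidableEq ι] in
theorem expect_sqrt_le (s : Finset ι) {f : ι → ℝ} (hf : ∀ i ∈ s, 0 ≤ f i) :
    𝔼 i ∈ s, √(f i) ≤ √(𝔼 i ∈ s, f i) := by
  refine Real.le_sqrt_of_sq_le ?_
  rw [← expect_congr rfl fun i hi => Real.sq_sqrt (hf i hi), expect_eq_sum_div_card,
    expect_eq_sum_div_card]
  exact sum_div_card_sq_le_sum_sq_div_card

end Expectation

section Fibers

variable {U V : Type*} [Fintype U] [DecidableEq U] [Fintype V] [Nonempty V] [DecidableEq V]

theorem expect_pow_card_fiber (i : V) (t : ℝ) :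
    𝔼 v : U → V, t ^ #{k | v k = i} = (1 - (1 - t) / Fintype.card V) ^ Fintype.card U := by
  have expect_one_user : 𝔼 a : V, (if a = i then t else 1) = 1 - (1 - t) / Fintype.card V := by
    have ite_eq : ∀ a : V, (if a = i then t else 1) = 1 - if a = i then 1 - t else 0 := fun a => by
      split_ifs <;> ring
    simp only [ite_eq, expect_sub_distrib, Fintype.expect_const]
    rw [Fintype.expect_eq_sum_div_card, Fintype.sum_ite_eq']
  have h := expect_piFinset_prod (fun _ : U => univ_nonempty) univ
    (fun _ (a : V) => if a = i then t else 1)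
  simpa only [Fintype.piFinset_univ, expect_one_user, prod_ite, prod_const, one_pow, mul_one,
    card_univ] using h

/-- The Chernoff bound for the lower tail, with the exponential moment kept as the parameter
`t = exp (-λ)`. -/
theorem expect_card_fiber_lt_le (i : V) (g : ℕ) {t : ℝ} (ht : 0 < t) (ht1 : t ≤ 1) :
    (𝔼 v : U → V, if #{k | v k = i} < g then (1 : ℝ) else 0) ≤
      Real.exp (-((1 - t) * (Fintype.card U / Fintype.card V))) / t ^ g := by
  have hV : (1 : ℝ) ≤ Fintype.card V := by exact_mod_cast Fintype.card_pos
  have markov (v : U → V) :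
      (if #{k | v k = i} < g then (1 : ℝ) else 0) ≤ t ^ #{k | v k = i} / t ^ g := by
    split_ifs with h
    · rw [one_le_div (by positivity)]
      exact pow_le_pow_of_le_one ht.le ht1 h.le
    · positivity
  calc (𝔼 v : U → V, if #{k | v k = i} < g then (1 : ℝ) else 0)
      ≤ 𝔼 v : U → V, t ^ #{k | v k = i} / t ^ g := expect_le_expect fun v _ => markov v
    _ = (1 - (1 - t) / Fintype.card V) ^ Fintype.card U / t ^ g := by
        rw [← expect_div, expect_pow_card_fiber]
    _ ≤ Real.exp (-((1 - t) / Fintype.card V)) ^ Fintype.card U / t ^ g := by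
        gcongr
        · rw [sub_nonneg, div_le_one (by positivity)]
          linarith
        · exact Real.one_sub_le_exp_neg _
    _ = Real.exp (-((1 - t) * (Fintype.card U / Fintype.card V))) / t ^ g := by
        rw [← Real.exp_nat_mul]
        congr 2
        ring

end Fibers

section Delivery

variable {U P : Type} [DecidableEq U] [Fintype P] [DecidableEq P] {N : ℕ}

/-- The packets requested by `k` and stored exactly in `B \ {k}` that `C` does not cover. -/
def uncovered (S : Config U P N) (d : U → Fin N) (C : Finset (U × P)) (B : Finset U) (k : U) :
    Finset P :=
  {f | (k, f) ∉ C ∧ S (d k) f = B.erase k}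

theorem uncovered_anti (S : Config U P N) (d : U → Fin N) {C C' : Finset (U × P)} (h : C ⊆ C')
    (B : Finset U) (k : U) : uncovered S d C' B k ⊆ uncovered S d C B k :=
  monotone_filter_right _ fun _ _ hf => ⟨fun hC => hf.1 (h hC), hf.2⟩

theorem mk_mem_partners (σ : Schedule U P) (S : Config U P N) (d : U → Fin N)
    (C : Finset (U × P)) {x : U × P} {j : U} (hj : j ∈ S (d x.1) x.2)
    (h : (candidates S d C x j).Nonempty) : (j, (σ.pick _ h).1) ∈ partners σ S d C x :=
  mem_biUnion.2 ⟨j, hj, by simp [h]⟩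

theorem uncovered_insert_partners_ssubset (σ : Schedule U P) (S : Config U P N) (d : U → Fin N)
    {C : Finset (U × P)} {x : U × P} (hx : x.1 ∉ S (d x.1) x.2) (hC : x ∉ C) {k : U}
    (hk : k ∈ insert x.1 (S (d x.1) x.2))
    (hne : (uncovered S d C (insert x.1 (S (d x.1) x.2)) k).Nonempty) :
    uncovered S d (C ∪ insert x (partners σ S d C x)) (insert x.1 (S (d x.1) x.2)) k ⊂
      uncovered S d C (insert x.1 (S (d x.1) x.2)) k := by
  refine (ssubset_iff_of_subset (uncovered_anti S d subset_union_left _ k)).2 ?_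
  rcases eq_or_ne k x.1 with rfl | hkx
  · exact ⟨x.2, by simp [uncovered, hC, erase_insert hx], by simp [uncovered]⟩
  · have candidates_nonempty : (candidates S d C x k).Nonempty := hne
    have covered := mk_mem_partners σ S d C (mem_of_mem_insert_of_ne hk hkx) candidates_nonempty
    exact ⟨(σ.pick _ candidates_nonempty).1, (σ.pick _ candidates_nonempty).2,
      by simp [uncovered, covered]⟩

variable [Fintype U]

/-- The potential of the greedy delivery once the packets in `C` are covered: the sum over all sets
`B` of users of the largest number of uncovered packets of a member of `B`. -/
def remaining (S : Config U P N) (d : U → Fin N) (C : Finset (U × P)) : ℕ :=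
  ∑ B : Finset U, B.sup fun k => #(uncovered S d C B k)

theorem remaining_lt (σ : Schedule U P) (S : Config U P N) (d : U → Fin N) {C : Finset (U × P)}
    {x : U × P} (hx : x.1 ∉ S (d x.1) x.2) (hC : x ∉ C) :
    remaining S d (C ∪ insert x (partners σ S d C x)) < remaining S d C := by
  have x_uncovered : x.2 ∈ uncovered S d C (insert x.1 (S (d x.1) x.2)) x.1 := by
    simp [uncovered, hC, erase_insert hx]
  have le_sup_of_mem {k : U} (hk : k ∈ insert x.1 (S (d x.1) x.2)) :=
    le_sup (f := fun k => #(uncovered S d C (insert x.1 (S (d x.1) x.2)) k)) hk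
  have sup_pos := (card_pos.2 ⟨_, x_uncovered⟩).trans_le (le_sup_of_mem (mem_insert_self _ _))
  refine sum_lt_sum
    (fun B _ => sup_mono_fun fun k _ => card_le_card (uncovered_anti S d subset_union_left B k))
    ⟨insert x.1 (S (d x.1) x.2), mem_univ _, (Finset.sup_lt_iff sup_pos).2 fun k hk => ?_⟩
  rcases (uncovered S d C (insert x.1 (S (d x.1) x.2)) k).eq_empty_or_nonempty with
    uncovered_eq | uncovered_nonempty
  · rwa [subset_empty.1 ((uncovered_anti S d subset_union_left _ k).trans uncovered_eq.subset),
      card_empty]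
  · exact (card_lt_card (uncovered_insert_partners_ssubset σ S d hx hC hk
      uncovered_nonempty)).trans_le (le_sup_of_mem hk)

theorem length_foldl_deliveryStep_le (σ : Schedule U P) (S : Config U P N) (d : U → Fin N)
    (l : List (U × P)) (st : Finset (U × P) × List (Finset (U × P))) :
    (l.foldl (deliveryStep σ S d) st).2.length ≤ st.2.length + remaining S d st.1 := by
  induction l generalizing st with
  | nil => exact Nat.le_add_right _ _
  | cons x l ih =>
    rw [List.foldl_cons]
    refine (ih _).trans ?_
    unfold deliveryStep
    split_ifs with h
    · exact le_rfl
    · exact (Nat.succ_add_eq_add_succ _ _).trans_le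
        (Nat.add_le_add_left (remaining_lt σ S d (not_or.1 h).1 (not_or.1 h).2) _)

theorem length_newDelivery_le (σ : Schedule U P) (S : Config U P N) (d : U → Fin N) :
    (newDelivery σ S d).length ≤ remaining S d ∅ :=
  (length_foldl_deliveryStep_le σ S d σ.order (∅, [])).trans_eq (Nat.zero_add _)

omit [DecidableEq P] in
theorem sum_card_filter_eq_erase_le {g : ℕ} {S : P → Finset U} (hS : ∀ f, #(S f) ≤ g) (k : U) :
    ∑ B with k ∈ B ∧ #B ≠ g + 1, #{f | S f = B.erase k} ≤ #{f | #(S f) < g} := by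
  have fiber (B : Finset U) (hB : B ∈ ({B | k ∈ B ∧ #B ≠ g + 1} : Finset (Finset U))) :
      #{f | S f = B.erase k} ≤ #{f | #(S f) < g ∧ insert k (S f) = B} := by
    obtain ⟨hkB, hcard⟩ := (mem_filter_univ B).1 hB
    refine card_le_card fun f hf => ?_
    rw [mem_filter_univ] at hf ⊢
    have hSf := hS f
    have := card_erase_add_one hkB
    rw [hf] at hSf ⊢
    exact ⟨by omega, insert_erase hkB⟩
  calc ∑ B with k ∈ B ∧ #B ≠ g + 1, #{f | S f = B.erase k}
      ≤ ∑ B with k ∈ B ∧ #B ≠ g + 1, #{f | #(S f) < g ∧ insert k (S f) = B} := sum_le_sum fiber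
    _ ≤ ∑ B, #{f | #(S f) < g ∧ insert k (S f) = B} :=
        sum_le_univ_sum_of_nonneg fun _ => Nat.zero_le _
    _ = #{f | #(S f) < g} := by
        simp only [← filter_filter]
        exact (card_eq_sum_card_fiberwise fun _ _ => mem_coe.2 (mem_univ _)).symm

theorem remaining_empty_le {g : ℕ} (S : Config U P N) (d : U → Fin N)
    (hS : ∀ n f, #(S n f) ≤ g) :
    remaining S d ∅ ≤ ∑ B ∈ powersetCard (g + 1) (univ : Finset U),
        (B.sup fun k => #{f | S (d k) f = B.erase k}) + ∑ k, #{f | #(S (d k) f) < g} := by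
  have uncovered_empty (B : Finset U) (k : U) :
      uncovered S d ∅ B k = ({f | S (d k) f = B.erase k} : Finset P) := by
    simp only [uncovered, notMem_empty, not_false_eq_true, true_and]
  have other_sizes : ∑ B : Finset U with #B ≠ g + 1, B.sup (fun k => #{f | S (d k) f = B.erase k}) ≤
      ∑ k, #{f | #(S (d k) f) < g} :=
    calc ∑ B : Finset U with #B ≠ g + 1, B.sup (fun k => #{f | S (d k) f = B.erase k})
        ≤ ∑ B : Finset U with #B ≠ g + 1, ∑ k ∈ B, #{f | S (d k) f = B.erase k} :=
          sum_le_sum fun B _ => Finset.sup_le fun _ hk =>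
            single_le_sum (f := fun k => #{f | S (d k) f = B.erase k})
              (fun _ _ => Nat.zero_le _) hk
      _ = ∑ k, ∑ B with k ∈ B ∧ #B ≠ g + 1, #{f | S (d k) f = B.erase k} :=
          sum_comm' fun B k => by simp [and_comm]
      _ ≤ ∑ k, #{f | #(S (d k) f) < g} :=
          sum_le_sum fun k _ => sum_card_filter_eq_erase_le (hS (d k)) k
  simp only [remaining, uncovered_empty]
  rw [← sum_filter_add_sum_filter_not univ fun B : Finset U => #B = g + 1,
    powersetCard_eq_filter, powerset_univ]
  exact Nat.add_le_add_left other_sizes _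

end Delivery

section PullDownProb

variable {U : Type*}

/-- The possible outcomes of the pull-down phase for a packet stored in `R`. -/
def pullDownChoices (g : ℕ) (R : Finset U) : Finset (Finset U) :=
  if g + 1 ≤ #R then R.powersetCard g else {R}

theorem mem_pullDownChoices {g : ℕ} {R A : Finset U} :
    A ∈ pullDownChoices g R ↔ (g + 1 ≤ #R ∧ A ⊆ R ∧ #A = g) ∨ (#R ≤ g ∧ A = R) := by
  unfold pullDownChoices
  split_ifs with h
  · simp only [mem_powersetCard, h, true_and, Nat.not_le.2 h, false_and, or_false]
  · simp only [mem_singleton, h, false_and, false_or, Nat.not_lt.1 h, true_and]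

theorem pullDownChoices_nonempty (g : ℕ) (R : Finset U) : (pullDownChoices g R).Nonempty := by
  unfold pullDownChoices
  split_ifs with h
  · exact powersetCard_nonempty.2 (Nat.le_of_succ_le h)
  · exact singleton_nonempty R

variable [DecidableEq U]

/-- The probability that the pull-down phase turns `R` into `A`. -/
noncomputable def pullDownProb (g : ℕ) (A R : Finset U) : ℝ :=
  𝔼 A' ∈ pullDownChoices g R, if A' = A then 1 else 0

theorem pullDownProb_nonneg (g : ℕ) (A R : Finset U) : 0 ≤ pullDownProb g A R :=
  expect_nonneg fun _ _ => by split_ifs <;> norm_num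

theorem pullDownProb_eq_zero {g : ℕ} {A R : Finset U} (h : ¬ A ⊆ R) : pullDownProb g A R = 0 := by
  refine expect_eq_zero fun A' hA' => if_neg ?_
  rintro rfl
  rcases mem_pullDownChoices.1 hA' with ⟨-, hsub, -⟩ | ⟨-, heq⟩
  · exact h hsub
  · exact h heq.subset

theorem pullDownProb_map (g : ℕ) (A R : Finset U) (π : Equiv.Perm U) :
    pullDownProb g (A.map π.toEmbedding) (R.map π.toEmbedding) = pullDownProb g A R := by
  symm
  refine expect_equiv π.finsetCongr (fun A' => ?_) (fun A' _ => ?_)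
  · simp [mem_pullDownChoices, map_subset_map]
  · simp

theorem sum_pullDownProb_le (g : ℕ) (R : Finset U) (s : Finset (Finset U)) :
    ∑ A ∈ s, pullDownProb g A R ≤ 1 := by
  unfold pullDownProb
  rw [← expect_sum_comm]
  refine expect_le (pullDownChoices_nonempty g R) fun A' _ => ?_
  rw [sum_ite_eq]
  split_ifs <;> norm_num

end PullDownProb

section StoredProb

variable {U V : Type*} [Fintype U] [DecidableEq U] [Fintype V] [DecidableEq V]

/-- The probability that a packet ends up stored exactly in `A` after the pull-down phase, when
every user stores a uniformly random packet of its group `V` and the packet is number `i`. -/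
noncomputable def storedProb (g : ℕ) (i : V) (A : Finset U) : ℝ :=
  𝔼 v : U → V, pullDownProb g A {k | v k = i}

theorem storedProb_nonneg (g : ℕ) (i : V) (A : Finset U) : 0 ≤ storedProb g i A :=
  expect_nonneg fun _ _ => pullDownProb_nonneg _ _ _

theorem storedProb_eq_of_card_eq (g : ℕ) (i : V) {A A' : Finset U} (h : #A = #A') :
    storedProb g i A = storedProb g i A' := by
  let e : {x // x ∈ A} ≃ {x // x ∈ A'} := equivOfCardEq h
  let π : Equiv.Perm U := e.extendSubtype
  have map_A : A.map π.toEmbedding = A' := by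
    refine eq_of_subset_of_card_le (fun y hy => ?_) (by rw [card_map, h])
    obtain ⟨x, hx, rfl⟩ := mem_map.1 hy
    exact e.extendSubtype_mem x hx
  refine Fintype.expect_equiv (Equiv.arrowCongr π (Equiv.refl V)) _ _ fun v => ?_
  have map_fiber : ({k | v k = i} : Finset U).map π.toEmbedding =
      ({k | Equiv.arrowCongr π (Equiv.refl V) v k = i} : Finset U) := by
    ext k
    simp [mem_map_equiv]
  rw [← pullDownProb_map g A _ π, map_A, map_fiber]

theorem storedProb_le [Nonempty V] {g : ℕ} (i : V) {A : Finset U} (hA : #A = g) :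
    storedProb g i A ≤ 1 / (Fintype.card U).choose g := by
  have choose_pos : (0 : ℝ) < (Fintype.card U).choose g :=
    Nat.cast_pos.2 (Nat.choose_pos (hA ▸ card_le_univ A))
  have total : ∑ A' ∈ powersetCard g (univ : Finset U), storedProb g i A' ≤ 1 := by
    unfold storedProb
    rw [← expect_sum_comm]
    exact expect_le univ_nonempty fun v _ => sum_pullDownProb_le g _ _
  have const_on_card (A' : Finset U) (hA' : A' ∈ powersetCard g univ) :
      storedProb g i A' = storedProb g i A :=
    storedProb_eq_of_card_eq g i ((mem_powersetCard.1 hA').2.trans hA.symm)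
  rw [sum_congr rfl const_on_card, sum_const, card_powersetCard, card_univ, nsmul_eq_mul] at total
  rwa [le_div_iff₀' choose_pos]

end StoredProb

section PullDown

variable {U P : Type} [Fintype P] [DecidableEq P] {N : ℕ}

theorem pullDown_eq (g : ℕ) (S : Config U P N) :
    pullDown g S = Fintype.piFinset fun n => Fintype.piFinset fun f => pullDownChoices g (S n f) :=
  rfl

theorem pullDown_nonempty (g : ℕ) (S : Config U P N) : (pullDown g S).Nonempty := by
  simp only [pullDown_eq, Fintype.piFinset_nonempty]
  exact fun n f => pullDownChoices_nonempty g _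

theorem mem_pullDown {g : ℕ} {S T : Config U P N} :
    T ∈ pullDown g S ↔ ∀ n f, T n f ∈ pullDownChoices g (S n f) := by
  simp only [pullDown_eq, Fintype.mem_piFinset]

theorem card_le_of_mem_pullDown {g : ℕ} {S T : Config U P N} (hT : T ∈ pullDown g S)
    (n : Fin N) (f : P) : #(T n f) ≤ g := by
  rcases mem_pullDownChoices.1 (mem_pullDown.1 hT n f) with ⟨-, -, hcard⟩ | ⟨hcard, hTS⟩
  · exact hcard.le
  · rwa [hTS]

theorem card_lt_iff_of_mem_pullDown {g : ℕ} {S T : Config U P N} (hT : T ∈ pullDown g S)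
    (n : Fin N) (f : P) : #(T n f) < g ↔ #(S n f) < g := by
  rcases mem_pullDownChoices.1 (mem_pullDown.1 hT n f) with ⟨hS, -, hcard⟩ | ⟨-, hTS⟩
  · omega
  · rw [hTS]

theorem expect_pullDown_apply (g : ℕ) (S : Config U P N) (n : Fin N) (f : P)
    (φ : Finset U → ℝ) :
    𝔼 T ∈ pullDown g S, φ (T n f) = 𝔼 A ∈ pullDownChoices g (S n f), φ A :=
  (expect_piFinset_apply (fun _ => Fintype.piFinset_nonempty.2 fun _ =>
    pullDownChoices_nonempty g _) n fun v : P → Finset U => φ (v f)).trans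
  (expect_piFinset_apply (fun _ => pullDownChoices_nonempty g _) f φ)

theorem expect_pullDown_mul (g : ℕ) (S : Config U P N) (n : Fin N) {f f' : P} (hf : f ≠ f')
    (φ ψ : Finset U → ℝ) :
    𝔼 T ∈ pullDown g S, φ (T n f) * ψ (T n f') =
      (𝔼 A ∈ pullDownChoices g (S n f), φ A) * 𝔼 A ∈ pullDownChoices g (S n f'), ψ A :=
  (expect_piFinset_apply (fun _ => Fintype.piFinset_nonempty.2 fun _ =>
    pullDownChoices_nonempty g _) n fun v : P → Finset U => φ (v f) * ψ (v f')).trans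
  (expect_piFinset_mul (fun _ => pullDownChoices_nonempty g _) hf φ ψ)

end PullDown

section Placement

variable {U : Type} [Fintype U] [DecidableEq U] {N F' q : ℕ}

/-- A placement, read as the family of its columns: for every file and every group of packets, the
packet of the group that each user stores. Uniform placements have i.i.d. uniform columns. -/
def Placement.columns : Placement U N F' q ≃ (Fin N × Fin F' → U → Fin q) where
  toFun ω p k := ω k p.1 p.2
  invFun v k n l := v (n, l) k

theorem expect_placement_column [NeZero q] (n : Fin N) (l : Fin F') (φ : (U → Fin q) → ℝ) :
    𝔼 ω : Placement U N F' q, φ (fun k => ω k n l) = 𝔼 v, φ v := by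
  rw [Fintype.expect_equiv Placement.columns (fun ω => φ fun k => ω k n l)
    (fun x => φ (x (n, l))) fun _ => rfl]
  simpa only [Fintype.piFinset_univ] using
    expect_piFinset_apply (fun _ : Fin N × Fin F' => univ_nonempty (α := U → Fin q)) (n, l) φ

theorem expect_placement_column_mul [NeZero q] (n : Fin N) {l l' : Fin F'} (hl : l ≠ l')
    (φ ψ : (U → Fin q) → ℝ) :
    𝔼 ω : Placement U N F' q, φ (fun k => ω k n l) * ψ (fun k => ω k n l') =
      (𝔼 v, φ v) * 𝔼 v, ψ v := by
  rw [Fintype.expect_equiv Placement.columns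
    (fun ω => φ (fun k => ω k n l) * ψ (fun k => ω k n l'))
    (fun x => φ (x (n, l)) * ψ (x (n, l'))) fun _ => rfl]
  simpa only [Fintype.piFinset_univ] using expect_piFinset_mul
    (fun _ : Fin N × Fin F' => univ_nonempty (α := U → Fin q))
    (fun h => hl (congrArg Prod.snd h) : (n, l) ≠ (n, l')) φ ψ

/-- The expectation of a function of the cache configuration after placement and pull-down. -/
noncomputable def pulledExpect (g : ℕ) (φ : Config U (Fin F' × Fin q) N → ℝ) : ℝ :=
  𝔼 ω : Placement U N F' q, 𝔼 T ∈ pullDown g ω.config, φ T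

theorem pulledExpect_add (g : ℕ) (φ ψ : Config U (Fin F' × Fin q) N → ℝ) :
    pulledExpect g (fun T => φ T + ψ T) = pulledExpect g φ + pulledExpect g ψ := by
  simp only [pulledExpect, expect_add_distrib]

theorem pulledExpect_const_mul (g : ℕ) (a : ℝ) (φ : Config U (Fin F' × Fin q) N → ℝ) :
    pulledExpect g (fun T => a * φ T) = a * pulledExpect g φ := by
  simp only [pulledExpect, mul_expect]

theorem pulledExpect_sum (g : ℕ) {ι : Type*} (s : Finset ι)
    (φ : ι → Config U (Fin F' × Fin q) N → ℝ) :
    pulledExpect g (fun T => ∑ i ∈ s, φ i T) = ∑ i ∈ s, pulledExpect g (φ i) := by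
  simp only [pulledExpect, expect_sum_comm]

theorem pulledExpect_const [NeZero q] (g : ℕ) (a : ℝ) :
    pulledExpect g (fun _ : Config U (Fin F' × Fin q) N => a) = a := by
  simp only [pulledExpect, expect_const (pullDown_nonempty g _)]
  exact Fintype.expect_const a

theorem pulledExpect_mono (g : ℕ) {φ ψ : Config U (Fin F' × Fin q) N → ℝ}
    (h : ∀ T, (∀ n f, #(T n f) ≤ g) → φ T ≤ ψ T) : pulledExpect g φ ≤ pulledExpect g ψ :=
  expect_le_expect fun _ _ => expect_le_expect fun T hT => h T (card_le_of_mem_pullDown hT)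

theorem pulledExpect_sqrt_le (g : ℕ) {φ : Config U (Fin F' × Fin q) N → ℝ} (hφ : ∀ T, 0 ≤ φ T) :
    pulledExpect g (fun T => √(φ T)) ≤ √(pulledExpect g φ) :=
  (expect_le_expect fun _ _ => expect_sqrt_le _ fun T _ => hφ T).trans
    (expect_sqrt_le _ fun _ _ => expect_nonneg fun T _ => hφ T)

theorem pulledExpect_indicator [NeZero q] (g : ℕ) (n : Fin N) (f : Fin F' × Fin q)
    (A : Finset U) :
    pulledExpect g (fun T => if T n f = A then 1 else 0) = storedProb g f.2 A :=
  (expect_congr rfl fun ω _ =>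
    expect_pullDown_apply g ω.config n f fun R => if R = A then (1 : ℝ) else 0).trans
  (expect_placement_column n f.1 fun v => pullDownProb g A {k | v k = f.2})

/-- Packets of different groups are independent, and no user stores two packets of one group. -/
theorem pulledExpect_indicator_mul_le [NeZero q] (g : ℕ) (n : Fin N) {f f' : Fin F' × Fin q}
    (hf : f ≠ f') {A : Finset U} (hA : A.Nonempty) :
    pulledExpect g (fun T => (if T n f = A then 1 else 0) * (if T n f' = A then 1 else 0)) ≤
      storedProb g f.2 A * storedProb g f'.2 A := by
  have given_placement (ω : Placement U N F' q) :=
    expect_pullDown_mul g ω.config n hf (fun R => if R = A then (1 : ℝ) else 0)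
      fun R => if R = A then (1 : ℝ) else 0
  refine (expect_congr rfl fun ω _ => given_placement ω).trans_le ?_
  by_cases group_eq : f.1 = f'.1
  · refine (expect_eq_zero fun ω _ => ?_).trans_le
      (mul_nonneg (storedProb_nonneg g f.2 A) (storedProb_nonneg g f'.2 A))
    by_contra h
    have subset := not_imp_comm.1 pullDownProb_eq_zero (left_ne_zero_of_mul h)
    have subset' := not_imp_comm.1 pullDownProb_eq_zero (right_ne_zero_of_mul h)
    obtain ⟨k, hk⟩ := hA
    have stored : ω k n f.1 = f.2 := (mem_filter_univ k).1 (subset hk)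
    have stored' : ω k n f'.1 = f'.2 := (mem_filter_univ k).1 (subset' hk)
    exact hf (Prod.ext group_eq (by rw [← stored, ← stored', group_eq]))
  · exact (expect_placement_column_mul n group_eq (fun v => pullDownProb g A {k | v k = f.2})
      fun v => pullDownProb g A {k | v k = f'.2}).le

theorem pulledExpect_card_lt_le [NeZero q] (g : ℕ) (n : Fin N) (f : Fin F' × Fin q) :
    pulledExpect g (fun T : Config U (Fin F' × Fin q) N => if #(T n f) < g then 1 else 0) ≤
      3 ^ g * Real.exp (-(2 / 3 * (Fintype.card U / q))) := by
  have given_placement (ω : Placement U N F' q) :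
      (𝔼 T ∈ pullDown g ω.config, if #(T n f) < g then (1 : ℝ) else 0) =
        if #(ω.config n f) < g then 1 else 0 := by
    rw [expect_congr rfl fun T hT => if_congr (card_lt_iff_of_mem_pullDown hT n f) rfl rfl,
      expect_const (pullDown_nonempty g _)]
  calc pulledExpect g (fun T : Config U (Fin F' × Fin q) N => if #(T n f) < g then 1 else 0)
      = 𝔼 ω : Placement U N F' q, if #(ω.config n f) < g then 1 else 0 :=
        expect_congr rfl fun ω _ => given_placement ω
    _ = 𝔼 v : U → Fin q, if #{k | v k = f.2} < g then 1 else 0 :=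
        expect_placement_column n f.1 fun v : U → Fin q => if #{k | v k = f.2} < g then 1 else 0
    _ ≤ Real.exp (-((1 - 1 / 3) * (Fintype.card U / Fintype.card (Fin q)))) / (1 / 3) ^ g :=
        expect_card_fiber_lt_le f.2 g (by norm_num) (by norm_num)
    _ = 3 ^ g * Real.exp (-(2 / 3 * (Fintype.card U / q))) := by
        rw [Fintype.card_fin, one_div, inv_pow, div_inv_eq_mul, mul_comm]
        norm_num

/-- The mean number of packets of a file stored exactly in `A` after the pull-down phase, when the
file consists of `F'` groups of `q` packets. -/
noncomputable def storedMean (F' q g : ℕ) (A : Finset U) : ℝ :=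
  ∑ f : Fin F' × Fin q, storedProb g f.2 A

theorem storedMean_le [NeZero q] {g : ℕ} {A : Finset U} (hA : #A = g) :
    storedMean F' q g A ≤ F' * q / (Fintype.card U).choose g :=
  (sum_le_card_nsmul _ _ _ fun f _ => storedProb_le f.2 hA).trans_eq <| by
    simp [div_eq_mul_inv]

theorem pulledExpect_count [NeZero q] (g : ℕ) (n : Fin N) (A : Finset U) :
    pulledExpect g (fun T : Config U (Fin F' × Fin q) N => (#{f | T n f = A} : ℝ)) =
      storedMean F' q g A := by
  simp only [card_filter, Nat.cast_sum, Nat.cast_ite, Nat.cast_one, Nat.cast_zero,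
    pulledExpect_sum, pulledExpect_indicator, storedMean]

theorem pulledExpect_count_sq_le [NeZero q] (g : ℕ) (n : Fin N) {A : Finset U}
    (hA : A.Nonempty) :
    pulledExpect g (fun T : Config U (Fin F' × Fin q) N => (#{f | T n f = A} : ℝ) ^ 2) ≤
      storedMean F' q g A + storedMean F' q g A ^ 2 := by
  have diagonal (f : Fin F' × Fin q) : pulledExpect g (fun T : Config U (Fin F' × Fin q) N =>
      (if T n f = A then (1 : ℝ) else 0) * (if T n f = A then 1 else 0)) = storedProb g f.2 A := by
    simp only [ite_zero_mul_ite_zero, mul_one, and_self, pulledExpect_indicator]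
  simp only [card_filter, Nat.cast_sum, Nat.cast_ite, Nat.cast_one, Nat.cast_zero, sq,
    sum_mul_sum, pulledExpect_sum, storedMean]
  rw [← sum_add_distrib]
  refine sum_le_sum fun f _ => ?_
  rw [← add_sum_erase _ _ (mem_univ f), diagonal]
  gcongr
  calc _ ≤ ∑ f' ∈ univ.erase f, storedProb g f.2 A * storedProb g f'.2 A :=
        sum_le_sum fun f' hf' =>
          pulledExpect_indicator_mul_le g n (ne_of_mem_erase hf').symm hA
    _ ≤ ∑ f' : Fin F' × Fin q, storedProb g f.2 A * storedProb g f'.2 A :=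
        sum_le_univ_sum_of_nonneg fun f' =>
          mul_nonneg (storedProb_nonneg _ _ _) (storedProb_nonneg _ _ _)

theorem pulledExpect_variance_le [NeZero q] (g : ℕ) (n : Fin N) {A : Finset U}
    (hA : A.Nonempty) :
    pulledExpect g (fun T : Config U (Fin F' × Fin q) N =>
      ((#{f | T n f = A} : ℝ) - storedMean F' q g A) ^ 2) ≤ storedMean F' q g A := by
  have expand (T : Config U (Fin F' × Fin q) N) :
      ((#{f | T n f = A} : ℝ) - storedMean F' q g A) ^ 2 = (#{f | T n f = A} : ℝ) ^ 2 +
        (-(2 * storedMean F' q g A) * (#{f | T n f = A} : ℝ) + storedMean F' q g A ^ 2) := by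
    ring
  simp only [expand, pulledExpect_add, pulledExpect_const_mul, pulledExpect_count,
    pulledExpect_const]
  linarith [pulledExpect_count_sq_le (F' := F') (q := q) g n hA]

end Placement

section Rate

theorem natCast_sup_le_add_sqrt {ι : Type*} (s : Finset ι) (X : ι → ℕ) {m : ι → ℝ} {Λ : ℝ}
    (hΛ : 0 ≤ Λ) (hm : ∀ i ∈ s, m i ≤ Λ) :
    ((s.sup X : ℕ) : ℝ) ≤ Λ + √(∑ i ∈ s, (X i - m i) ^ 2) := by
  rcases s.eq_empty_or_nonempty with rfl | hs
  · simpa using hΛ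
  · obtain ⟨i, hi, sup_eq⟩ := exists_mem_eq_sup s hs X
    have deviation_le : (X i : ℝ) - m i ≤ √(∑ i ∈ s, (X i - m i) ^ 2) :=
      Real.le_sqrt_of_sq_le
        (single_le_sum (f := fun i => ((X i : ℝ) - m i) ^ 2) (fun _ _ => sq_nonneg _) hi)
    rw [sup_eq]
    linarith [hm i hi]

theorem choose_succ_div_choose_le (n k : ℕ) :
    (n.choose (k + 1) : ℝ) / n.choose k ≤ n / (k + 1) := by
  rcases Nat.eq_zero_or_pos (n.choose k) with h | h
  · rw [h, Nat.cast_zero, div_zero]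
    positivity
  · rw [div_le_div_iff₀ (Nat.cast_pos.2 h) (by positivity)]
    have step : n.choose (k + 1) * (k + 1) ≤ n * n.choose k :=
      (Nat.choose_succ_right_eq n k).trans_le
        ((Nat.mul_le_mul_left _ (Nat.sub_le n k)).trans_eq (Nat.mul_comm _ _))
    exact_mod_cast step

theorem add_sqrt_mul_eq {a b : ℝ} (hb : 0 < b) : b + √(a * b) = b * (1 + √(a / b)) := by
  have sqrt_eq : √(a * b) = b * √(a / b) := by
    rw [← Real.sqrt_sq hb.le, ← Real.sqrt_mul (sq_nonneg b), Real.sqrt_sq hb.le]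
    congr 1
    field_simp
  rw [sqrt_eq, mul_one_add]

variable {U : Type} [Fintype U] [DecidableEq U] {N F' q : ℕ}

theorem deliveryRate_le {P : Type} [Fintype P] [DecidableEq P] {g : ℕ} (σ : Schedule U P)
    {T : Config U P N} (hT : ∀ n f, #(T n f) ≤ g) (d : U → Fin N) :
    deliveryRate σ T d ≤ (Fintype.card P : ℝ)⁻¹ *
      (∑ B ∈ powersetCard (g + 1) univ, ((B.sup fun k => #{f | T (d k) f = B.erase k} : ℕ) : ℝ) +
        ∑ k, ∑ f, if #(T (d k) f) < g then 1 else 0) := by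
  rw [deliveryRate, div_eq_inv_mul]
  gcongr
  exact_mod_cast ((length_newDelivery_le σ T d).trans (remaining_empty_le T d hT)).trans_eq
    (by simp only [card_filter])

theorem pulledExpect_sup_count_le [NeZero q] {g : ℕ} (hg : 0 < g) (d : U → Fin N) {Λ : ℝ}
    (hΛ : F' * q / (Fintype.card U).choose g ≤ Λ) {B : Finset U} (hB : #B = g + 1) :
    pulledExpect g (fun T : Config U (Fin F' × Fin q) N =>
      ((B.sup fun k => #{f | T (d k) f = B.erase k} : ℕ) : ℝ)) ≤ Λ + √((g + 1) * Λ) := by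
  have card_erase (k : U) (hk : k ∈ B) : #(B.erase k) = g := by
    rw [card_erase_of_mem hk, hB, Nat.add_sub_cancel]
  have mean_le (k : U) (hk : k ∈ B) : storedMean F' q g (B.erase k) ≤ Λ :=
    (storedMean_le (card_erase k hk)).trans hΛ
  have variance_le (k : U) (hk : k ∈ B) := (pulledExpect_variance_le (F' := F') (q := q) g (d k)
    (card_pos.1 (by rwa [card_erase k hk]))).trans (mean_le k hk)
  calc pulledExpect g (fun T : Config U (Fin F' × Fin q) N =>
        ((B.sup fun k => #{f | T (d k) f = B.erase k} : ℕ) : ℝ))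
      ≤ pulledExpect g (fun T : Config U (Fin F' × Fin q) N => Λ + √(∑ k ∈ B,
          ((#{f | T (d k) f = B.erase k} : ℝ) - storedMean F' q g (B.erase k)) ^ 2)) :=
        pulledExpect_mono g fun T _ =>
          natCast_sup_le_add_sqrt B _ (le_trans (by positivity) hΛ) mean_le
    _ ≤ Λ + √(∑ k ∈ B, pulledExpect g (fun T : Config U (Fin F' × Fin q) N =>
          ((#{f | T (d k) f = B.erase k} : ℝ) - storedMean F' q g (B.erase k)) ^ 2)) := by
        rw [pulledExpect_add, pulledExpect_const, ← pulledExpect_sum]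
        gcongr
        exact pulledExpect_sqrt_le g fun T => sum_nonneg fun _ _ => sq_nonneg _
    _ ≤ Λ + √((g + 1) * Λ) := by
        gcongr
        refine (sum_le_card_nsmul _ _ _ variance_le).trans_eq ?_
        rw [hB, nsmul_eq_mul, Nat.cast_add_one]

theorem pulledExpect_deliveryRate_le [NeZero q] (hF : 0 < F') {g : ℕ} (hg : 0 < g)
    (hgU : g ≤ Fintype.card U) (σ : Schedule U (Fin F' × Fin q)) (d : U → Fin N) {Λ : ℝ}
    (hΛ : F' * q / (Fintype.card U).choose g = Λ) :
    pulledExpect g (fun T => deliveryRate σ T d) ≤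
      Fintype.card U / (g + 1) * (1 + √((g + 1) / Λ)) +
        Fintype.card U * (3 ^ g * Real.exp (-(2 / 3 * (Fintype.card U / q)))) := by
  have q_pos : (0 : ℝ) < q := Nat.cast_pos.2 (Nat.pos_of_neZero q)
  have choose_pos : (0 : ℝ) < (Fintype.card U).choose g := Nat.cast_pos.2 (Nat.choose_pos hgU)
  have Λ_pos : 0 < Λ := hΛ ▸ by positivity
  have full_le := sum_le_card_nsmul (powersetCard (g + 1) (univ : Finset U)) _ _ fun B hB =>
    pulledExpect_sup_count_le (F' := F') (q := q) hg d hΛ.le (mem_powersetCard.1 hB).2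
  have small_le (k : U) := sum_le_card_nsmul (univ : Finset (Fin F' × Fin q)) _ _ fun f _ =>
    pulledExpect_card_lt_le (U := U) g (d k) f
  have small_sum_le := sum_le_card_nsmul (univ : Finset U) _ _ fun k _ => small_le k
  simp only [card_powersetCard, card_univ, nsmul_eq_mul, Fintype.card_prod, Fintype.card_fin,
    Nat.cast_mul] at full_le small_sum_le
  calc pulledExpect g (fun T => deliveryRate σ T d)
      ≤ _ := pulledExpect_mono g fun T hT => deliveryRate_le σ hT d
    _ ≤ (F' * q : ℝ)⁻¹ * ((Fintype.card U).choose (g + 1) * (Λ + √((g + 1) * Λ)) +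
          Fintype.card U * (F' * q * (3 ^ g * Real.exp (-(2 / 3 * (Fintype.card U / q)))))) := by
        simp only [pulledExpect_const_mul, pulledExpect_add, pulledExpect_sum, Fintype.card_prod,
          Fintype.card_fin, Nat.cast_mul]
        gcongr
    _ = (Fintype.card U).choose (g + 1) / (Fintype.card U).choose g * (1 + √((g + 1) / Λ)) +
          Fintype.card U * (3 ^ g * Real.exp (-(2 / 3 * (Fintype.card U / q)))) := by
        rw [add_sqrt_mul_eq Λ_pos]
        generalize √((g + 1) / Λ) = s, Real.exp _ = E
        rw [← hΛ]
        field_simp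
    _ ≤ _ := by
        gcongr ?_ * _ + _
        exact choose_succ_div_choose_le _ _

theorem expectedTotalRate_eq [NeZero q] {K m : ℕ} (g : ℕ) (grp : Fin K → Fin m)
    (σ : ∀ j, Schedule (Group grp j) (Fin F' × Fin q)) (d : Fin K → Fin N) :
    expectedTotalRate g grp σ d =
      ∑ j, pulledExpect g (fun T => deliveryRate (σ j) T fun k => d k.1) := by
  have given_placement (j : Fin m) (ω : Placement (Fin K) N F' q) :=
    expect_piFinset_apply (fun j => pullDown_nonempty g (groupConfig grp ω j)) j
      fun T => deliveryRate (σ j) T fun k => d k.1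
  simp only [expectedTotalRate, expect_sum_comm, given_placement]
  exact sum_congr rfl fun j _ => expect_subtype_restrict (fun k => grp k = j)
    fun ω : Placement (Group grp j) N F' q =>
      𝔼 T ∈ pullDown g ω.config, deliveryRate (σ j) T fun k => d k.1

end Rate

section Bounds

theorem natCeil_pow_le_exp_mul_pow {y : ℝ} (hy : 0 < y) (n : ℕ) :
    (⌈y⌉₊ : ℝ) ^ n ≤ Real.exp (n / y) * y ^ n := by
  have ceil_le : (⌈y⌉₊ : ℝ) ≤ Real.exp (1 / y) * y :=
    calc (⌈y⌉₊ : ℝ) ≤ y + 1 := (Nat.ceil_lt_add_one hy.le).le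
      _ = (1 / y + 1) * y := by field_simp; ring
      _ ≤ Real.exp (1 / y) * y := by
        gcongr
        exact Real.add_one_le_exp _
  calc (⌈y⌉₊ : ℝ) ^ n ≤ (Real.exp (1 / y) * y) ^ n := by gcongr
    _ = Real.exp (n / y) * y ^ n := by rw [mul_pow, ← Real.exp_nat_mul, mul_one_div]

theorem pow_le_choose_of_mul_le {m k n : ℕ} (h : (m + 1) * k ≤ n) : m ^ k ≤ n.choose k := by
  have base_le : m * k ≤ n + 1 - k := by
    rw [add_mul, one_mul] at h
    omega
  refine Nat.le_of_mul_le_mul_left ?_ k.factorial_pos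
  calc k.factorial * m ^ k ≤ k ^ k * m ^ k := Nat.mul_le_mul_right _ k.factorial_le_pow
    _ = (m * k) ^ k := by rw [mul_pow, mul_comm]
    _ ≤ (n + 1 - k) ^ k := Nat.pow_le_pow_left base_le k
    _ ≤ n.descFactorial k := n.pow_sub_le_descFactorial k
    _ = k.factorial * n.choose k := n.descFactorial_eq_factorial_mul_choose k

theorem choose_natCeil_mul_le {z : ℝ} (hz : 1 ≤ z) (k : ℕ) :
    (⌈z * k⌉₊.choose k : ℝ) ≤ Real.exp 1 * (Real.exp 1 * z) ^ k := by
  rcases Nat.eq_zero_or_pos k with rfl | hk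
  · simp
  have hk' : (0 : ℝ) < k := Nat.cast_pos.2 hk
  calc (⌈z * k⌉₊.choose k : ℝ)
      ≤ (⌈z * k⌉₊ : ℝ) ^ k / k.factorial := Nat.choose_le_pow_div k _
    _ ≤ Real.exp (k / (z * k)) * (z * k) ^ k / k.factorial := by
        gcongr
        exact natCeil_pow_le_exp_mul_pow (by positivity) k
    _ ≤ Real.exp 1 * (z * k) ^ k / k.factorial := by
        gcongr
        rw [div_le_one (by positivity)]
        exact le_mul_of_one_le_left hk'.le hz
    _ = Real.exp 1 * (z ^ k * (k ^ k / k.factorial)) := by ring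
    _ ≤ Real.exp 1 * (z ^ k * Real.exp k) := by
        gcongr
        exact Real.pow_div_factorial_le_exp _ hk'.le k
    _ = Real.exp 1 * (Real.exp 1 * z) ^ k := by
        rw [mul_pow, ← Real.exp_nat_mul, mul_one, mul_comm (z ^ k)]

theorem succ_mul_succ_succ_le_pow (n : ℕ) :
    ((n : ℝ) + 1) * (n + 2) ≤ 18 * (4 / 3) ^ n := by
  have strengthened : (n : ℝ) ^ 2 + 5 * n + 18 ≤ 18 * (4 / 3) ^ n := by
    induction n with
    | zero => norm_num
    | succ n ih =>
      have : (n : ℝ) ≤ (n : ℝ) ^ 2 := by exact_mod_cast Nat.le_self_pow two_ne_zero n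
      rw [pow_succ (4 / 3 : ℝ)]
      push_cast
      linarith
  have : (0 : ℝ) ≤ n := n.cast_nonneg
  linarith

theorem half_le_log {x : ℝ} (hx : 2 ≤ x) : 1 / 2 ≤ Real.log x :=
  calc (1 / 2 : ℝ) = 1 - 2⁻¹ := by norm_num
    _ ≤ 1 - x⁻¹ := by gcongr
    _ ≤ Real.log x := Real.one_sub_inv_le_log_of_pos (by linarith)

end Bounds

section Parameters

variable {N : ℕ} {M : ℝ} {g : ℕ}

theorem two_lt_div_of_exp_one_le_ratio (h : Real.exp 1 ≤ ratio N M) : 2 < (N : ℝ) / M := by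
  have two_lt_ratio : 2 < ratio N M := by exact_mod_cast Real.exp_one_gt_two.trans_le h
  exact_mod_cast Nat.lt_ceil.1 two_lt_ratio

theorem div_le_ratio (N : ℕ) (M : ℝ) : (N : ℝ) / M ≤ ratio N M := Nat.le_ceil _

theorem three_le_ratio (hx : 2 < (N : ℝ) / M) : (3 : ℝ) ≤ ratio N M := by
  have two_lt_ratio : 2 < ratio N M := Nat.lt_ceil.2 (by exact_mod_cast hx)
  exact_mod_cast two_lt_ratio

theorem ratio_le_sq (hx : 2 < (N : ℝ) / M) : (ratio N M : ℝ) ≤ ((N : ℝ) / M) ^ 2 := by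
  have : (ratio N M : ℝ) < N / M + 1 := Nat.ceil_lt_add_one (by linarith)
  nlinarith

theorem groupSize_eq (N : ℕ) (M : ℝ) (g : ℕ) :
    groupSize N M g = ⌈3 * ratio N M * Real.log (N / M) * g⌉₊ := by
  rw [groupSize]
  congr 1
  ring

theorem le_groupSize (N : ℕ) (M : ℝ) (g : ℕ) :
    3 * ratio N M * Real.log (N / M) * g ≤ groupSize N M g := by
  rw [groupSize_eq]
  exact Nat.le_ceil _

theorem four_le_three_mul_ratio_mul_log (hx : 2 < (N : ℝ) / M) :
    4 ≤ 3 * ratio N M * Real.log (N / M) := by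
  nlinarith [three_le_ratio hx, half_le_log hx.le]

theorem four_mul_le_groupSize (hx : 2 < (N : ℝ) / M) (g : ℕ) : 4 * g ≤ groupSize N M g := by
  have : (4 * g : ℝ) ≤ groupSize N M g :=
    (mul_le_mul_of_nonneg_right (four_le_three_mul_ratio_mul_log hx) g.cast_nonneg).trans
      (le_groupSize N M g)
  exact_mod_cast this

theorem le_log_choose (hx : 2 < (N : ℝ) / M) (g : ℕ) :
    g ≤ Real.log ((groupSize N M g).choose g) := by
  have three_pow_le : (3 : ℝ) ^ g ≤ (groupSize N M g).choose g := by
    exact_mod_cast pow_le_choose_of_mul_le (four_mul_le_groupSize hx g)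
  rw [Real.le_log_iff_exp_le ((by positivity : (0 : ℝ) < 3 ^ g).trans_le three_pow_le)]
  calc Real.exp g = Real.exp 1 ^ g := by rw [← Real.exp_nat_mul, mul_one]
    _ ≤ 3 ^ g := by
        gcongr
        exact Real.exp_one_lt_three.le
    _ ≤ _ := three_pow_le

theorem choose_mul_sq_le_groupOrder (hx : 2 < (N : ℝ) / M) (g : ℕ) :
    (groupSize N M g).choose g * (g : ℝ) ^ 2 ≤ groupOrder N M g := by
  unfold groupOrder
  gcongr
  exact le_log_choose hx g

theorem one_le_groupOrder (hx : 2 < (N : ℝ) / M) (hg : 0 < g) : 1 ≤ groupOrder N M g := by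
  have choose_pos : 0 < (groupSize N M g).choose g :=
    Nat.choose_pos (by linarith [four_mul_le_groupSize hx g])
  refine le_trans ?_ (choose_mul_sq_le_groupOrder hx g)
  exact_mod_cast Nat.mul_pos choose_pos (pow_pos hg 2)

theorem fileSize_le {c : ℝ} (hc : 0 ≤ c) (hx : 2 < (N : ℝ) / M) (hg : 0 < g) :
    fileSize c N M g ≤ (c + 1) * (groupOrder N M g * ratio N M) := by
  have order_ge := one_le_groupOrder hx hg
  have ceil_le : (⌈c * groupOrder N M g⌉₊ : ℝ) ≤ (c + 1) * groupOrder N M g := by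
    linarith [Nat.ceil_lt_add_one (mul_nonneg hc (zero_le_one.trans order_ge))]
  rw [fileSize, Nat.cast_mul, ← mul_assoc, mul_comm]
  gcongr

theorem choose_groupSize_le (hx : 2 < (N : ℝ) / M) (g : ℕ) :
    ((groupSize N M g).choose g : ℝ) ≤
      Real.exp 1 * (3 * Real.exp 1 * ratio N M * Real.log (N / M)) ^ g := by
  have one_le : 1 ≤ 3 * ratio N M * Real.log (N / M) := by
    linarith [four_le_three_mul_ratio_mul_log hx]
  rw [groupSize_eq]
  refine (choose_natCeil_mul_le one_le g).trans_eq ?_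
  ring

theorem log_choose_groupSize_le (hx : 2 < (N : ℝ) / M) (hg : 0 < g) :
    Real.log ((groupSize N M g).choose g) ≤ 11 * g * Real.log (N / M) := by
  have choose_pos : (0 : ℝ) < (groupSize N M g).choose g :=
    Nat.cast_pos.2 (Nat.choose_pos (by linarith [four_mul_le_groupSize hx g]))
  have log_ge := half_le_log hx.le
  have ratio_ge := three_le_ratio hx
  have hg' : (1 : ℝ) ≤ g := Nat.one_le_cast.2 hg
  have log_three_le : Real.log 3 ≤ 2 := by
    linarith [Real.log_le_sub_one_of_pos (zero_lt_three (α := ℝ))]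
  have log_ratio_le : Real.log (ratio N M) ≤ 2 * Real.log (N / M) := by
    rw [← Nat.cast_two, ← Real.log_pow]
    exact Real.log_le_log (by linarith) (ratio_le_sq hx)
  have log_log_le : Real.log (Real.log (N / M)) ≤ Real.log (N / M) :=
    Real.log_le_self (by linarith)
  calc Real.log ((groupSize N M g).choose g)
      ≤ Real.log (Real.exp 1 * (3 * Real.exp 1 * ratio N M * Real.log (N / M)) ^ g) :=
        Real.log_le_log choose_pos (choose_groupSize_le hx g)
    _ = 1 + g * (Real.log 3 + 1 + Real.log (ratio N M) + Real.log (Real.log (N / M))) := by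
        rw [Real.log_mul (by positivity) (by positivity), Real.log_pow,
          Real.log_mul (by positivity) (by positivity),
          Real.log_mul (by positivity) (by positivity),
          Real.log_mul (by positivity) (by positivity), Real.log_exp]
    _ ≤ g * (2 * Real.log (N / M)) + g * (9 * Real.log (N / M)) := by
        gcongr
        · nlinarith
        · linarith
    _ = 11 * g * Real.log (N / M) := by ring

theorem groupOrder_le (hx : 2 < (N : ℝ) / M) (hg : 0 < g) :
    groupOrder N M g ≤ 121 * Real.exp 1 *
      ((ratio N M : ℝ) ^ g * (3 * Real.exp 1) ^ g * Real.log (N / M) ^ (g + 2) * g ^ 2) := by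
  have log_ge := half_le_log hx.le
  calc groupOrder N M g
      ≤ Real.exp 1 * (3 * Real.exp 1 * ratio N M * Real.log (N / M)) ^ g *
          (11 * g * Real.log (N / M)) ^ 2 := by
        unfold groupOrder
        gcongr
        · exact choose_groupSize_le hx g
        · exact log_choose_groupSize_le hx hg
    _ = _ := by ring

theorem fileSize_le_pow {c : ℝ} (hc : 0 ≤ c) (hx : 2 < (N : ℝ) / M) (hg : 0 < g) :
    fileSize c N M g ≤ 121 * Real.exp 1 * (c + 1) *
      ((ratio N M : ℝ) ^ (g + 1) * (3 * Real.exp 1) ^ g * Real.log (N / M) ^ (g + 2) * g ^ 2) := by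
  refine (fileSize_le hc hx hg).trans ?_
  calc (c + 1) * (groupOrder N M g * ratio N M)
      ≤ (c + 1) * (121 * Real.exp 1 * ((ratio N M : ℝ) ^ g * (3 * Real.exp 1) ^ g *
          Real.log (N / M) ^ (g + 2) * g ^ 2) * ratio N M) := by
        gcongr
        exact groupOrder_le hx hg
    _ = _ := by ring

theorem ratio_pow_succ_le (hx : 2 < (N : ℝ) / M) {A : ℝ} (hA : g ≤ A * (N / M)) :
    (ratio N M : ℝ) ^ (g + 1) ≤ Real.exp (A + 1) * ((N : ℝ) / M) ^ (g + 1) := by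
  refine (natCeil_pow_le_exp_mul_pow (by linarith) (g + 1)).trans ?_
  gcongr
  rw [div_le_iff₀ (by linarith)]
  push_cast
  linarith

theorem mul_sq_le_div_choose {c : ℝ} (hc : 0 ≤ c) (hx : 2 < (N : ℝ) / M) {F' : ℕ}
    (hF : fileSize c N M g ≤ ratio N M * F') :
    c * g ^ 2 * ratio N M ≤ F' * ratio N M / (groupSize N M g).choose g := by
  have choose_pos : (0 : ℝ) < (groupSize N M g).choose g :=
    Nat.cast_pos.2 (Nat.choose_pos (by linarith [four_mul_le_groupSize hx g]))
  have ratio_pos : 0 < ratio N M := by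
    exact_mod_cast zero_lt_three.trans_le (three_le_ratio hx)
  have order_le : c * groupOrder N M g ≤ F' :=
    Nat.ceil_le.1 (Nat.le_of_mul_le_mul_left hF ratio_pos)
  rw [le_div_iff₀ choose_pos]
  calc c * g ^ 2 * ratio N M * (groupSize N M g).choose g
      = c * ((groupSize N M g).choose g * (g : ℝ) ^ 2) * ratio N M := by ring
    _ ≤ c * groupOrder N M g * ratio N M := by
        gcongr
        exact choose_mul_sq_le_groupOrder hx g
    _ ≤ F' * ratio N M := by gcongr

theorem three_pow_mul_exp_le_pow (hx : 2 < (N : ℝ) / M) (g : ℕ) :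
    3 ^ g * Real.exp (-(2 / 3 * (groupSize N M g / ratio N M))) ≤
      (3 / ((N : ℝ) / M) ^ 2) ^ g := by
  have ratio_pos : (0 : ℝ) < ratio N M := zero_lt_three.trans_le (three_le_ratio hx)
  have exponent_le : 3 * Real.log (N / M) * g ≤ groupSize N M g / ratio N M := by
    rw [le_div_iff₀ ratio_pos]
    linarith [le_groupSize N M g]
  have exp_eq : Real.exp (2 * Real.log (N / M)) = ((N : ℝ) / M) ^ 2 := by
    rw [two_mul, Real.exp_add, Real.exp_log (by linarith), sq]
  calc 3 ^ g * Real.exp (-(2 / 3 * (groupSize N M g / ratio N M)))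
      ≤ 3 ^ g * Real.exp (-(2 / 3 * (3 * Real.log (N / M) * g))) := by gcongr
    _ = 3 ^ g * Real.exp (g * -(2 * Real.log (N / M))) := by
        congr 2
        ring
    _ = (3 / ((N : ℝ) / M) ^ 2) ^ g := by
        rw [Real.exp_nat_mul, ← mul_pow, Real.exp_neg, exp_eq,
          div_eq_mul_inv (3 : ℝ)]

theorem three_pow_mul_exp_le_one_div_mul (hx : 2 < (N : ℝ) / M) (hg : 0 < g) :
    3 ^ g * Real.exp (-(2 / 3 * (groupSize N M g / ratio N M))) ≤
      1 / (g + 1) * (54 / (ratio N M * g)) := by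
  obtain ⟨n, rfl⟩ := Nat.exists_eq_add_one.2 hg
  have ratio_pos : (0 : ℝ) < ratio N M := zero_lt_three.trans_le (three_le_ratio hx)
  have base_le : 3 / ((N : ℝ) / M) ^ 2 ≤ 3 / 4 := by
    gcongr
    nlinarith
  have base_le_ratio : 3 / ((N : ℝ) / M) ^ 2 ≤ 3 / ratio N M := by
    gcongr
    exact ratio_le_sq hx
  refine (three_pow_mul_exp_le_pow hx _).trans ?_
  calc (3 / ((N : ℝ) / M) ^ 2) ^ (n + 1)
      ≤ (3 / 4) ^ n * (3 / ratio N M) := by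
        rw [pow_succ]
        gcongr
    _ ≤ 18 / ((n + 1) * (n + 2)) * (3 / ratio N M) := by
        gcongr ?_ * _
        rw [le_div_iff₀ (by positivity)]
        calc (3 / 4 : ℝ) ^ n * ((n + 1) * (n + 2))
            ≤ (3 / 4) ^ n * (18 * (4 / 3) ^ n) := by
              gcongr _ * ?_
              exact succ_mul_succ_succ_le_pow n
          _ = 18 := by
              rw [mul_left_comm, ← mul_pow]
              norm_num
    _ = 1 / ((n + 1 : ℕ) + 1) * (54 / (ratio N M * (n + 1 : ℕ))) := by
        push_cast
        field_simp
        ring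

theorem sqrt_groupSize_le (hx : 2 < (N : ℝ) / M) (hg : 0 < g) :
    √(groupSize N M g) ≤ 2 * (ratio N M * g) := by
  have ratio_ge := three_le_ratio hx
  have hg' : (1 : ℝ) ≤ g := Nat.one_le_cast.2 hg
  have log_ge := half_le_log hx.le
  have log_le : Real.log (N / M) ≤ ratio N M :=
    (Real.log_le_self (by linarith)).trans (div_le_ratio N M)
  refine Real.sqrt_le_iff.2 ⟨by positivity, ?_⟩
  calc (groupSize N M g : ℝ)
      ≤ 3 * ratio N M * Real.log (N / M) * g + 1 := by
        rw [groupSize_eq]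
        exact (Nat.ceil_lt_add_one (by positivity)).le
    _ ≤ 3 * ratio N M * ratio N M * (g * g) + ratio N M * ratio N M * (g * g) := by
        gcongr
        · exact le_mul_of_one_le_left (by positivity) hg'
        · nlinarith [mul_le_mul hg' hg' zero_le_one (by positivity)]
    _ = (2 * (ratio N M * g)) ^ 2 := by ring

/-- The relative excess of the expected rate over `K / (g + 1)` as a function of the group size `n`
and of the constant `c` in the file size. The first term comes from the fluctuations of the numbers
of packets stored at exactly `g` users, the second one from packets stored at fewer users. -/
noncomputable def rateError (c : ℝ) (n : ℕ) : ℝ := √(4 / (c * √n)) + 108 / √n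

theorem rateError_nonneg (c : ℝ) (n : ℕ) : 0 ≤ rateError c n := by
  unfold rateError
  positivity

theorem tendsto_rateError {c : ℝ} (hc : 0 < c) :
    Filter.Tendsto (rateError c) Filter.atTop (nhds 0) := by
  have sqrt_atTop : Filter.Tendsto (fun n : ℕ => √(n : ℝ)) Filter.atTop Filter.atTop :=
    Real.tendsto_sqrt_atTop.comp tendsto_natCast_atTop_atTop
  have sum_tendsto := ((sqrt_atTop.const_mul_atTop hc).const_div_atTop 4).sqrt.add
    (sqrt_atTop.const_div_atTop 108)
  rwa [Real.sqrt_zero, add_zero] at sum_tendsto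

theorem error_terms_le_rateError {c : ℝ} (hc : 0 < c) (hx : 2 < (N : ℝ) / M) (hg : 0 < g) {Λ : ℝ}
    (hΛ : c * g ^ 2 * ratio N M ≤ Λ) :
    √((g + 1) / Λ) + 54 / (ratio N M * g) ≤ rateError c (groupSize N M g) := by
  have hg' : (1 : ℝ) ≤ g := Nat.one_le_cast.2 hg
  have ratio_pos : (0 : ℝ) < ratio N M := zero_lt_three.trans_le (three_le_ratio hx)
  have sqrt_le := sqrt_groupSize_le hx hg
  have sqrt_pos : 0 < √(groupSize N M g : ℝ) :=
    Real.sqrt_pos.2 (Nat.cast_pos.2 (by linarith [four_mul_le_groupSize hx g]))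
  unfold rateError
  refine add_le_add (Real.sqrt_le_sqrt ?_) ?_
  · calc (g + 1) / Λ ≤ 2 * g / (c * g ^ 2 * ratio N M) := by
          gcongr
          linarith
      _ = 4 / (c * (2 * (ratio N M * g))) := by
          field_simp
          norm_num
      _ ≤ 4 / (c * √(groupSize N M g)) := by gcongr
  · calc 54 / (ratio N M * g : ℝ) = 108 / (2 * (ratio N M * g)) := by
          field_simp
          norm_num
      _ ≤ 108 / √(groupSize N M g) := by gcongr

theorem pulledExpect_deliveryRate_le_rateError {c : ℝ} (hc : 0 < c) (hx : 2 < (N : ℝ) / M)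
    (hg : 0 < g) {F' : ℕ} (hF : fileSize c N M g ≤ ratio N M * F') {U : Type} [Fintype U]
    [DecidableEq U] (hU : Fintype.card U = groupSize N M g)
    (σ : Schedule U (Fin F' × Fin (ratio N M))) (d : U → Fin N) :
    pulledExpect g (fun T => deliveryRate σ T d) ≤
      groupSize N M g / (g + 1) * (1 + rateError c (groupSize N M g)) := by
  have ratio_pos : 0 < ratio N M := by exact_mod_cast zero_lt_three.trans_le (three_le_ratio hx)
  have : NeZero (ratio N M) := ⟨ratio_pos.ne'⟩
  have mean_ge := mul_sq_le_div_choose hc.le hx hF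
  have F'_pos : 0 < F' := by
    refine Nat.pos_of_ne_zero ?_
    rintro rfl
    have : 0 < c * g ^ 2 * (ratio N M : ℝ) := by positivity
    simp only [Nat.cast_zero, zero_mul, zero_div] at mean_ge
    linarith
  calc pulledExpect g (fun T => deliveryRate σ T d)
      ≤ _ := pulledExpect_deliveryRate_le F'_pos hg
        (by linarith [hU, four_mul_le_groupSize hx g]) σ d rfl
    _ ≤ groupSize N M g / (g + 1) *
          (1 + √((g + 1) / (F' * ratio N M / (groupSize N M g).choose g))) +
        groupSize N M g * (1 / (g + 1) * (54 / (ratio N M * g))) := by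
      rw [hU]
      gcongr _ + _ * ?_
      exact three_pow_mul_exp_le_one_div_mul hx hg
    _ = groupSize N M g / (g + 1) *
          (1 + (√((g + 1) / (F' * ratio N M / (groupSize N M g).choose g)) +
            54 / (ratio N M * g))) := by ring
    _ ≤ _ := by
      gcongr
      exact error_terms_le_rateError hc hx hg mean_ge

theorem expectedTotalRate_le {c : ℝ} (hc : 0 < c) (hx : 2 < (N : ℝ) / M) (hg : 0 < g) {F' : ℕ}
    (hF : fileSize c N M g ≤ ratio N M * F') {K m : ℕ} {grp : Fin K → Fin m}
    (hgrp : ∀ j, Fintype.card (Group grp j) = groupSize N M g)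
    (σ : ∀ j, Schedule (Group grp j) (Fin F' × Fin (ratio N M))) (d : Fin K → Fin N) :
    expectedTotalRate g grp σ d ≤ K / (g + 1) * (1 + rateError c (groupSize N M g)) := by
  have ratio_pos : 0 < ratio N M := by exact_mod_cast zero_lt_three.trans_le (three_le_ratio hx)
  have : NeZero (ratio N M) := ⟨ratio_pos.ne'⟩
  have card_eq : (K : ℝ) = m * groupSize N M g := by
    have := card_eq_sum_card_fiberwise (s := univ) (t := univ) (f := grp) fun _ _ => by simp
    simp only [← Fintype.card_subtype, hgrp, sum_const, card_univ, Fintype.card_fin,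
      smul_eq_mul] at this
    exact_mod_cast this
  rw [expectedTotalRate_eq, card_eq]
  refine (sum_le_sum fun j _ => pulledExpect_deliveryRate_le_rateError hc hx hg hF (hgrp j)
    (σ j) fun k => d k.1).trans_eq ?_
  rw [sum_const, card_univ, Fintype.card_fin, nsmul_eq_mul]
  ring

end Parameters

end CodedCaching

open CodedCaching in
theorem theorem8_general {c : ℝ} (hc : 0 < c) :
    (∃ ε : ℕ → ℝ, Filter.Tendsto ε Filter.atTop (nhds 0) ∧ (∀ n, 0 ≤ ε n) ∧
      ∀ (N : ℕ) (M : ℝ) (g : ℕ), Real.exp 1 ≤ (ratio N M : ℝ) → 0 < g →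
      ∀ F' : ℕ, fileSize c N M g ≤ ratio N M * F' →
      ∀ (K m : ℕ) (grp : Fin K → Fin m),
        (∀ j, Fintype.card (Group grp j) = groupSize N M g) →
      ∀ (σ : ∀ j, Schedule (Group grp j) (Fin F' × Fin (ratio N M))) (d : Fin K → Fin N),
        expectedTotalRate g grp σ d ≤ (K : ℝ) / ((g : ℝ) + 1) * (1 + ε (groupSize N M g))) ∧
    (∃ C : ℝ, 0 < C ∧ ∀ (N : ℕ) (M : ℝ) (g : ℕ), Real.exp 1 ≤ (ratio N M : ℝ) → 0 < g →
      (fileSize c N M g : ℝ) ≤ C * (groupOrder N M g * (ratio N M : ℝ)) ∧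
      (fileSize c N M g : ℝ) ≤ C * ((ratio N M : ℝ) ^ (g + 1) * (3 * Real.exp 1) ^ g *
        Real.log ((N : ℝ) / M) ^ (g + 2) * (g : ℝ) ^ 2)) ∧
    (∀ A : ℝ, ∃ C : ℝ, 0 < C ∧ ∀ (N : ℕ) (M : ℝ) (g : ℕ), Real.exp 1 ≤ (ratio N M : ℝ) → 0 < g →
      (g : ℝ) ≤ A * ((N : ℝ) / M) →
      (fileSize c N M g : ℝ) ≤ C * (((N : ℝ) / M) ^ (g + 1) * (3 * Real.exp 1) ^ g *
        Real.log ((N : ℝ) / M) ^ (g + 2) * (g : ℝ) ^ 2)) := by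
  refine ⟨⟨rateError c, tendsto_rateError hc, rateError_nonneg c, ?_⟩,
    ⟨121 * Real.exp 1 * (c + 1), by positivity, ?_⟩,
    fun A => ⟨121 * Real.exp 1 * (c + 1) * Real.exp (A + 1), by positivity, ?_⟩⟩
  · intro N M g hr hg F' hF K m grp hgrp σ d
    exact expectedTotalRate_le hc (two_lt_div_of_exp_one_le_ratio hr) hg hF hgrp σ d
  · intro N M g hr hg
    have hx := two_lt_div_of_exp_one_le_ratio hr
    refine ⟨(fileSize_le hc.le hx hg).trans ?_, fileSize_le_pow hc.le hx hg⟩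
    have order_ge := one_le_groupOrder hx hg
    gcongr
    exact le_mul_of_one_le_left (by positivity) (by linarith [Real.add_one_le_exp 1])
  · intro N M g hr hg hA
    have hx := two_lt_div_of_exp_one_le_ratio hr
    have log_ge := half_le_log hx.le
    calc (fileSize c N M g : ℝ)
        ≤ 121 * Real.exp 1 * (c + 1) * ((ratio N M : ℝ) ^ (g + 1) * (3 * Real.exp 1) ^ g *
            Real.log ((N : ℝ) / M) ^ (g + 2) * (g : ℝ) ^ 2) := fileSize_le_pow hc.le hx hg
      _ ≤ 121 * Real.exp 1 * (c + 1) * (Real.exp (A + 1) * ((N : ℝ) / M) ^ (g + 1) *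
            (3 * Real.exp 1) ^ g * Real.log ((N : ℝ) / M) ^ (g + 2) * (g : ℝ) ^ 2) := by
          gcongr
          exact ratio_pow_succ_le hx hA
      _ = _ := by ring

theorem theorem8 :
    ∃ c : ℝ, 0 < c ∧
      -- expected rate, for every file size `F = ⌈N/M⌉ F'` that is at least `fileSize c N M g`
      (∃ ε : ℕ → ℝ, Filter.Tendsto ε Filter.atTop (nhds 0) ∧
        ∀ (N : ℕ) (M : ℝ) (g : ℕ), CodedCaching.Admissible N M g →
        ∀ F' : ℕ, CodedCaching.fileSize c N M g ≤ CodedCaching.ratio N M * F' →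
        ∀ (K m : ℕ) (grp : Fin K → Fin m),
          (∀ j, Fintype.card (CodedCaching.Group grp j) = CodedCaching.groupSize N M g) →
        ∀ (σ : ∀ j, CodedCaching.Schedule (CodedCaching.Group grp j)
            (Fin F' × Fin (CodedCaching.ratio N M))) (d : Fin K → Fin N),
          CodedCaching.expectedTotalRate g grp σ d ≤
            4 / 3 * ((K : ℝ) / ((g : ℝ) + 1)) * (1 + ε (CodedCaching.groupSize N M g))) ∧
      -- the order of this file size
      (∃ C : ℝ, 0 < C ∧ ∀ (N : ℕ) (M : ℝ) (g : ℕ), CodedCaching.Admissible N M g →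
        (CodedCaching.fileSize c N M g : ℝ) ≤
            C * (CodedCaching.groupOrder N M g * (CodedCaching.ratio N M : ℝ)) ∧
        (CodedCaching.fileSize c N M g : ℝ) ≤
            C * ((CodedCaching.ratio N M : ℝ) ^ (g + 1) * (3 * Real.exp 1) ^ g *
              Real.log ((N : ℝ) / M) ^ (g + 2) * (g : ℝ) ^ 2)) ∧
      (∀ A : ℝ, ∃ C : ℝ, 0 < C ∧ ∀ (N : ℕ) (M : ℝ) (g : ℕ), CodedCaching.Admissible N M g →
        (g : ℝ) ≤ A * ((N : ℝ) / M) →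
        (CodedCaching.fileSize c N M g : ℝ) ≤
            C * (((N : ℝ) / M) ^ (g + 1) * (3 * Real.exp 1) ^ g *
              Real.log ((N : ℝ) / M) ^ (g + 2) * (g : ℝ) ^ 2)) := by
  obtain ⟨⟨ε, tendsto_ε, ε_nonneg, rate_le⟩, ⟨C, C_pos, size_le⟩, size_le_of_le⟩ :=
    theorem8_general one_pos
  refine ⟨1, one_pos, ⟨ε, tendsto_ε, ?_⟩, ⟨C, C_pos, fun N M g h => ?_⟩, fun A => ?_⟩
  · intro N M g h F' hF K m grp hgrp σ d
    have := ε_nonneg (CodedCaching.groupSize N M g)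
    refine (rate_le N M g h.2.1 (by linarith [h.2.2.1]) F' hF K m grp hgrp σ d).trans ?_
    gcongr
    exact le_mul_of_one_le_left (by positivity) (by norm_num)
  · exact size_le N M g h.2.1 (by linarith [h.2.2.1])
  · obtain ⟨C_A, C_A_pos, size_le_A⟩ := size_le_of_le A
    exact ⟨C_A, C_A_pos, fun N M g h => size_le_A N M g h.2.1 (by linarith [h.2.2.1])⟩
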